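/- Let $m,n\ge 1$, $\Omega\subseteq\{1,\dots,m\}\times\{1,\dots,n\}$, $Y\in\mathbb R^{m\times n}$ and $\ell\ge 0$. For $A\in\mathbb R^{m\times n}$ let $P_\Omega(A)$ be the matrix that agrees with $A$ on the entries in $\Omega$ and is zero elsewhere, $P_\Omega^\perp(A)=A-P_\Omega(A)$, and let $\sigma_1(A)\ge\sigma_2(A)\ge\cdots$ be the singular values of $A$. Let $P:[0,\infty)\to\mathbb R$ be concave and differentiable (one-sidedly at $0$) with bounded derivative, and put $$\phi_P=\inf_{\alpha,\alpha'>0,\ \alpha\ne\alpha'}\frac{P'(\alpha)-P'(\alpha')}{\alpha-\alpha'}\in[-\infty,0],\qquad \nu^\dagger(\ell)=\max\{1+\phi_P+\ell,\,0\}.$$ For $X,Z\in\mathbb R^{m\times n}$ let $$F_\ell(X;Z)=\tfrac12\|P_\Omega(X-Y)\|_F^2+\tfrac12\|P_\Omega^\perp(X-Z)\|_F^2+\tfrac{\ell}{2}\|X-Z\|_F^2+\sum_{i=1}^{\min\{m,n\}}P(\sigma_i(X)),$$ $$\Delta_\ell(Z;X)=\tfrac{\nu^\dagger(\ell)+\ell}{2}\|X-Z\|_F^2+\tfrac12\|P_\Omega^\perp(X-Z)\|_F^2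 .$$ A matrix $Z$ is called a first-order stationary point (of the problem of minimizing $\frac12\|P_\Omega(X-Y)\|_F^2+\sum_i P(\sigma_i(X))$ over $X$) if $\Delta_\ell(Z;Z^+)=0$ for some $Z^+\in\operatorname{argmin}_X F_\ell(X;Z)$. Let $(X_k)$ be any sequence of $m\times n$ matrices with $X_{k+1}\in\operatorname{argmin}_X F_\ell(X;X_k)$ for all $k$, and for every $k$ let $X_k=U_k\operatorname{diag}(\boldsymbol\sigma_k)V_k'$ be a rank-reduced singular value decomposition (the columns of $U_k$, and those of $V_k$, are orthonormal, and $\boldsymbol\sigma_k$ has $\operatorname{rank}(X_k)$ entries, positive and in decreasing order). Let $\bar U\in\mathbb R^{m\times r}$, $\bar V\in\mathbb R^{n\times r}$ be a limit point of $(U_k,V_k)$: along a subsequence $n_k\to\infty$ one has $\operatorname{rank}(X_{n_k})=r$ and $(U_{n_k},V_{n_k})\to(\bar U,\bar V)$. Let $\bar u_i,\bar v_i$ be the columns of $\bar U,\bar V$, and let $\bar\Theta=[\operatorname{vec}(P_\Omega(\bar u_1\bar v_1')),\dots,\operatorname{vec}(P_\Omega(\bar u_r\bar v_r'))]\in\mathbb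 R^{mn\times r}$. Then: (a) If $\operatorname{rank}(\bar\Theta)=r$, then the sequence $(X_{n_k})$ has a limit point which is a first-order stationary point. (b) If $\lambda_{\min}(\bar\Theta'\bar\Theta)+\phi_P>0$ (where $\lambda_{\min}$ is the least eigenvalue, read as $+\infty$ if $r=0$), then $\boldsymbol\sigma_{n_k}$ converges to some $\bar{\boldsymbol\sigma}$, and $X_{n_k}$ converges to $\bar X=\bar U\operatorname{diag}(\bar{\boldsymbol\sigma})\bar V'$, which is a first-order stationary point. -/

import Mathlib

open Filter Topology

noncomputable section

namespace NCImpute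

/-- The projection `P_Ω`: keep the entries indexed by `Ω`, set the others to zero. -/
def proj {m n : ℕ} (Ω : Finset (Fin m × Fin n)) (A : Matrix (Fin m) (Fin n) ℝ) :
    Matrix (Fin m) (Fin n) ℝ :=
  Matrix.of fun i j => if (i, j) ∈ Ω then A i j else 0

/-- The complementary projection `P_Ω^⊥(A) = A - P_Ω(A)`. -/
def projPerp {m n : ℕ} (Ω : Finset (Fin m × Fin n)) (A : Matrix (Fin m) (Fin n) ℝ) :
    Matrix (Fin m) (Fin n) ℝ :=
  A - proj Ω A

/-- The squared Frobenius norm. -/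
def frobSq {m n : ℕ} (A : Matrix (Fin m) (Fin n) ℝ) : ℝ :=
  ∑ i, ∑ j, A i j ^ 2

/-- The spectral penalty `∑_{i ≤ min(m,n)} P(σ_i(X))`; `LinearMap.singularValues` lists the
singular values in decreasing order with multiplicity, starting at index zero. -/
def spectralPenalty {m n : ℕ} (P : ℝ → ℝ) (X : Matrix (Fin m) (Fin n) ℝ) : ℝ :=
  ∑ i ∈ Finset.range (min m n), P ((Matrix.toEuclideanLin X).singularValues i)

/-- The majorizing function `F_ℓ(X; Z)`. -/
def majorizer {m n : ℕ} (Ω : Finset (Fin m × Fin n)) (Y : Matrix (Fin m) (Fin n) ℝ)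
    (P : ℝ → ℝ) (ℓ : ℝ) (X Z : Matrix (Fin m) (Fin n) ℝ) : ℝ :=
  frobSq (proj Ω (X - Y)) / 2 + frobSq (projPerp Ω (X - Z)) / 2 + ℓ / 2 * frobSq (X - Z)
    + spectralPenalty P X

/-- `X` is a minimizer over all `m × n` matrices of `F_ℓ(·; Z)`, i.e. a possible successor of the
iterate `Z`. -/
def IsUpdate {m n : ℕ} (Ω : Finset (Fin m × Fin n)) (Y : Matrix (Fin m) (Fin n) ℝ)
    (P : ℝ → ℝ) (ℓ : ℝ) (Z X : Matrix (Fin m) (Fin n) ℝ) : Prop :=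
  IsMinOn (fun W => majorizer Ω Y P ℓ W Z) Set.univ X

/-- `φ_P = inf_{a ≠ b, a, b > 0} (P'(a) - P'(b)) / (a - b)`, an extended real, since it may
be `-∞`. -/
def phi (P : ℝ → ℝ) : EReal :=
  ⨅ (a : ℝ) (b : ℝ) (_ : 0 < a) (_ : 0 < b) (_ : a ≠ b),
    (((deriv P a - deriv P b) / (a - b) : ℝ) : EReal)

/-- `ν†(ℓ) = max {1 + φ_P + ℓ, 0}`; a real number, because `φ_P < +∞`. -/
def nuDagger (P : ℝ → ℝ) (ℓ : ℝ) : ℝ :=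
  (max (1 + phi P + (ℓ : EReal)) 0).toReal

/-- The progress measure `Δ_ℓ(Z; X)`. -/
def progress {m n : ℕ} (Ω : Finset (Fin m × Fin n)) (P : ℝ → ℝ) (ℓ : ℝ)
    (Z X : Matrix (Fin m) (Fin n) ℝ) : ℝ :=
  (nuDagger P ℓ + ℓ) / 2 * frobSq (X - Z) + frobSq (projPerp Ω (X - Z)) / 2

/-- `Z` is a first order stationary point: `Δ_ℓ(Z; Z⁺) = 0` for an update
`Z⁺ ∈ argmin F_ℓ(·; Z)`. -/
def IsFirstOrderStationary {m n : ℕ} (Ω : Finset (Fin m × Fin n))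
    (Y : Matrix (Fin m) (Fin n) ℝ) (P : ℝ → ℝ) (ℓ : ℝ) (Z : Matrix (Fin m) (Fin n) ℝ) : Prop :=
  ∃ Znext, IsUpdate Ω Y P ℓ Z Znext ∧ progress Ω P ℓ Z Znext = 0

/-- `A = U diag(s) V'` is a rank-reduced singular value decomposition: orthonormal columns and
positive singular values in decreasing order (so that `q` is the rank of `A`). -/
structure IsReducedSVD {m n q : ℕ} (A : Matrix (Fin m) (Fin n) ℝ) (U : Matrix (Fin m) (Fin q) ℝ)
    (s : Fin q → ℝ) (V : Matrix (Fin n) (Fin q) ℝ) : Prop where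
  orthoU : U.transpose * U = 1
  orthoV : V.transpose * V = 1
  pos : ∀ i, 0 < s i
  anti : Antitone s
  eq : A = U * Matrix.diagonal s * V.transpose

/-- The `mn × r` matrix with columns `vec(P_Ω(u_i v_i'))`. -/
def Theta {m n r : ℕ} (Ω : Finset (Fin m × Fin n)) (U : Matrix (Fin m) (Fin r) ℝ)
    (V : Matrix (Fin n) (Fin r) ℝ) : Matrix (Fin n × Fin m) (Fin r) ℝ :=
  Matrix.of fun p i => (proj Ω (Matrix.vecMulVec (U.col i) (V.col i))).vec p

/-- The least eigenvalue of a real symmetric matrix (`+∞` for the empty matrix). -/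
def lambdaMin {r : ℕ} (A : Matrix (Fin r) (Fin r) ℝ) : EReal :=
  ⨅ t ∈ spectrum ℝ A, (t : EReal)

end NCImpute

end

/-! ### Spectral penalty of a factorization with orthonormal factors -/

noncomputable section

namespace NCImpute

/-! The majorizer is `objective` plus a nonnegative quadratic `proximity`, which vanishes when its
two arguments agree. Each update therefore lowers the objective by at least its proximity to the
previous iterate, and the squared entries of `residual`, the gradient of that quadratic, are bounded
by a multiple of the proximity. If the objective stays bounded below along a subsequence, the
decreases are summable and all residuals tend to zero (`tendsto_residual`). Optimality of an update
`X` can be rewritten around `X` itself, the previous iterate entering only through a linear term in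
the residual (`IsUpdate.nonneg`). In the limit this term disappears, so a limit of iterates is an
update of itself, hence stationary (`isFirstOrderStationary_of_tendsto`).

What remains is compactness of the singular values. The loss is quadratic in them through `Theta`,
while the penalty decreases at most linearly because `P'` is bounded. If the limiting `Theta` is
injective, the bound on the objective by its initial value bounds the singular values
(`eventually_norm_le_of_objective_le`); this gives (a).

For (b), optimality in the direction of one singular value reads `P'(s k) = -⟨P_Ω(X - Y) + residual,
u_k v_k'⟩`. Subtracting this relation along two subsequences with limits `σ` and `τ`, multiplying by
`σ k - τ k` and summing gives `‖Theta (σ - τ)‖² + φ_P ‖σ - τ‖² ≤ 0` (`frobSq_add_phi_mul_nonpos`).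
The eigenvalue condition forces `σ = τ`, so the bounded sequence of singular values converges. -/

/-- A function vanishing at zero has the same sum over the squared singular values of
`U diag(s) V'` as over the squares of the entries of `s`. -/
theorem sum_eigenvalues_of_factorization {m n q : ℕ} {U : Matrix (Fin m) (Fin q) ℝ}
    {V : Matrix (Fin n) (Fin q) ℝ} (hU : U.transpose * U = 1) (hV : V.transpose * V = 1)
    (s : Fin q → ℝ) (g : ℝ → ℝ) (hg : g 0 = 0) :
    ∑ i, g ((Matrix.toEuclideanLin
        (U * Matrix.diagonal s * V.transpose)).isSymmetric_adjoint_comp_self.eigenvalues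
          (finrank_euclideanSpace_fin (𝕜 := ℝ) (n := n)) i) = ∑ k, g (s k ^ 2) := by
  set A := U * Matrix.diagonal s * V.transpose with hA
  have hAA : A.transpose * A =
      V * (Matrix.diagonal (fun k => s k ^ 2) * V.transpose) := by
    have h1 : A.transpose * A = V * (Matrix.diagonal s * (U.transpose * U) * Matrix.diagonal s)
        * V.transpose := by
      simp only [hA, Matrix.transpose_mul, Matrix.transpose_transpose, Matrix.diagonal_transpose,
        Matrix.mul_assoc]
    rw [h1, hU, Matrix.mul_one, Matrix.diagonal_mul_diagonal, Matrix.mul_assoc]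
    simp only [sq]
  have hcomp : LinearMap.adjoint (Matrix.toEuclideanLin A) ∘ₗ Matrix.toEuclideanLin A
      = Matrix.toEuclideanLin (A.transpose * A) := by
    rw [← Matrix.conjTranspose_eq_transpose_of_trivial,
      ← Matrix.toEuclideanLin_conjTranspose_eq_adjoint]
    ext x i
    simp [Matrix.toLpLin_apply, Matrix.mulVec_mulVec]
  have hchar : (LinearMap.adjoint (Matrix.toEuclideanLin A) ∘ₗ Matrix.toEuclideanLin A).charpoly
      = (A.transpose * A).charpoly := by
    rw [hcomp, Matrix.toEuclideanLin, Matrix.toLpLin_eq_toLin, Matrix.charpoly_toLin]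
  -- `BC` and `CB` have the same characteristic polynomial up to powers of `X`. These powers only
  -- contribute zero roots, where `g` vanishes.
  have hpoly : (Polynomial.X : Polynomial ℝ) ^ q * (A.transpose * A).charpoly
      = Polynomial.X ^ n * (Matrix.diagonal (fun k => s k ^ 2)).charpoly := by
    have h := Matrix.charpoly_mul_comm' V (Matrix.diagonal (fun k => s k ^ 2) * V.transpose)
    rw [Matrix.mul_assoc _ V.transpose V, hV, Matrix.mul_one, ← hAA] at h
    simpa using h
  have hroots := congrArg Polynomial.roots hpoly
  rw [← hchar, Polynomial.roots_mul (mul_ne_zero (pow_ne_zero _ Polynomial.X_ne_zero)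
      (LinearMap.charpoly_monic _).ne_zero),
    Polynomial.roots_mul (mul_ne_zero (pow_ne_zero _ Polynomial.X_ne_zero)
      (Matrix.charpoly_monic _).ne_zero),
    (Matrix.toEuclideanLin A).isSymmetric_adjoint_comp_self.roots_charpoly_eq_eigenvalues
      (finrank_euclideanSpace_fin (𝕜 := ℝ) (n := n)), Matrix.charpoly_diagonal,
    Polynomial.roots_prod _ _ (Finset.prod_ne_zero_iff.2 fun i _ => Polynomial.X_sub_C_ne_zero _),
    Polynomial.roots_X_pow, Polynomial.roots_X_pow] at hroots
  simp only [Polynomial.roots_X_sub_C, Multiset.bind_singleton] at hroots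
  have hsum := congrArg (fun M => (Multiset.map g M).sum) hroots
  simp only [Multiset.map_add, Multiset.map_nsmul, Multiset.sum_add, Multiset.sum_nsmul,
    Multiset.map_singleton, Multiset.sum_singleton, hg, nsmul_zero, zero_add,
    Multiset.map_map] at hsum
  exact hsum

/-- The entries of `s` may be unordered or zero. This lets one entry be varied freely, and lets
entries vanish in the limit without any appeal to continuity of singular values. -/
theorem spectralPenalty_of_factorization {m n q : ℕ} (P : ℝ → ℝ) {U : Matrix (Fin m) (Fin q) ℝ}
    {V : Matrix (Fin n) (Fin q) ℝ} (hU : U.transpose * U = 1) (hV : V.transpose * V = 1)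
    {s : Fin q → ℝ} (hs : ∀ k, 0 ≤ s k) :
    spectralPenalty P (U * Matrix.diagonal s * V.transpose)
      = (min m n : ℕ) * P 0 + ∑ k, (P (s k) - P 0) := by
  have h := sum_eigenvalues_of_factorization hU hV s (fun x => P (√x) - P 0) (by simp)
  simp only [Real.sqrt_sq (hs _)] at h
  rw [← h, spectralPenalty]
  set T := Matrix.toEuclideanLin (U * Matrix.diagonal s * V.transpose) with hT
  simp only [← T.singularValues_fin]
  -- There are `n` eigenvalues but only `min m n` penalty terms; the surplus singular values, with
  -- index at least `m`, vanish because the rank is at most `m`.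
  rw [Fin.sum_univ_eq_sum_range (fun i => P (T.singularValues i) - P 0) n,
    ← Finset.sum_subset (Finset.range_mono (min_le_right m n))]
  · simp
  · intro i hi hi'
    have hmi : m ≤ i := by
      simp only [Finset.mem_range] at hi hi'
      omega
    have h0 : T.singularValues i = 0 := by
      rw [LinearMap.singularValues_eq_zero_iff_le_finrank_range]
      exact (Submodule.finrank_le _).trans (by simpa using hmi)
    simp [h0]

end NCImpute

end

/-! ### Descent, vanishing residuals and stationarity of limits -/

noncomputable section

namespace NCImpute

/-- The part of the gradient of `F_ℓ(·; Z)` at `X` that depends on `X - Z`. -/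
def residual {m n : ℕ} (Ω : Finset (Fin m × Fin n)) (ℓ : ℝ) (X Z : Matrix (Fin m) (Fin n) ℝ) :
    Matrix (Fin m) (Fin n) ℝ :=
  projPerp Ω (X - Z) + ℓ • (X - Z)

/-- The objective function `½‖P_Ω(X - Y)‖² + ∑ P(σ_i(X))`. -/
def objective {m n : ℕ} (Ω : Finset (Fin m × Fin n)) (Y : Matrix (Fin m) (Fin n) ℝ) (P : ℝ → ℝ)
    (X : Matrix (Fin m) (Fin n) ℝ) : ℝ :=
  frobSq (proj Ω (X - Y)) / 2 + spectralPenalty P X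

/-- The part of `F_ℓ(X; Z)` that depends on `Z`. -/
def proximity {m n : ℕ} (Ω : Finset (Fin m × Fin n)) (ℓ : ℝ) (X Z : Matrix (Fin m) (Fin n) ℝ) : ℝ :=
  frobSq (projPerp Ω (X - Z)) / 2 + ℓ / 2 * frobSq (X - Z)

variable {m n : ℕ} {Ω : Finset (Fin m × Fin n)} {Y : Matrix (Fin m) (Fin n) ℝ} {P : ℝ → ℝ} {ℓ : ℝ}

theorem majorizer_eq (X Z : Matrix (Fin m) (Fin n) ℝ) :
    majorizer Ω Y P ℓ X Z = objective Ω Y P X + proximity Ω ℓ X Z := by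
  unfold majorizer objective proximity
  ring

theorem frobSq_nonneg (A : Matrix (Fin m) (Fin n) ℝ) : 0 ≤ frobSq A :=
  Finset.sum_nonneg fun _ _ => Finset.sum_nonneg fun _ _ => sq_nonneg _

theorem proximity_self (X : Matrix (Fin m) (Fin n) ℝ) : proximity Ω ℓ X X = 0 := by
  simp [proximity, projPerp, proj, frobSq]

theorem proximity_nonneg (hℓ : 0 ≤ ℓ) (X Z : Matrix (Fin m) (Fin n) ℝ) :
    0 ≤ proximity Ω ℓ X Z := by
  have h1 := frobSq_nonneg (projPerp Ω (X - Z))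
  have h2 := frobSq_nonneg (X - Z)
  unfold proximity
  positivity

theorem IsUpdate.objective_add_proximity_le {X Z : Matrix (Fin m) (Fin n) ℝ}
    (h : IsUpdate Ω Y P ℓ Z X) : objective Ω Y P X + proximity Ω ℓ X Z ≤ objective Ω Y P Z := by
  have h1 := h (Set.mem_univ Z)
  simp only [Set.mem_ofPred_eq, majorizer_eq, proximity_self] at h1
  linarith

theorem proximity_eq_sum (X Z : Matrix (Fin m) (Fin n) ℝ) :
    proximity Ω ℓ X Z
      = ∑ i, ∑ j, ((if (i, j) ∈ Ω then 0 else 1) + ℓ) / 2 * (X i j - Z i j) ^ 2 := by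
  simp only [proximity, frobSq, Finset.mul_sum, Finset.sum_div, ← Finset.sum_add_distrib]
  refine Finset.sum_congr rfl fun i _ => Finset.sum_congr rfl fun j _ => ?_
  by_cases h : (i, j) ∈ Ω <;> simp [projPerp, proj, h] ; ring

theorem residual_apply (X Z : Matrix (Fin m) (Fin n) ℝ) (i : Fin m) (j : Fin n) :
    residual Ω ℓ X Z i j = ((if (i, j) ∈ Ω then 0 else 1) + ℓ) * (X i j - Z i j) := by
  by_cases h : (i, j) ∈ Ω <;> simp [residual, projPerp, proj, h] ; ring

theorem residual_sq_le (hℓ : 0 ≤ ℓ) (X Z : Matrix (Fin m) (Fin n) ℝ) (i : Fin m) (j : Fin n) :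
    residual Ω ℓ X Z i j ^ 2 ≤ 2 * (1 + ℓ) * proximity Ω ℓ X Z := by
  have hw : ∀ i j, (0 : ℝ) ≤ (if (i, j) ∈ Ω then 0 else 1) + ℓ := fun i j => by
    split_ifs <;> linarith
  have hw' : (if (i, j) ∈ Ω then (0 : ℝ) else 1) + ℓ ≤ 1 + ℓ := by split_ifs <;> linarith
  have h1 : ((if (i, j) ∈ Ω then (0 : ℝ) else 1) + ℓ) / 2 * (X i j - Z i j) ^ 2
      ≤ proximity Ω ℓ X Z := by
    have hn : ∀ i j, 0 ≤ ((if (i, j) ∈ Ω then (0 : ℝ) else 1) + ℓ) / 2 * (X i j - Z i j) ^ 2 :=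
      fun i j => mul_nonneg (div_nonneg (hw i j) two_pos.le) (sq_nonneg _)
    rw [proximity_eq_sum]
    exact (Finset.single_le_sum (fun b _ => hn i b) (Finset.mem_univ j)).trans
      (Finset.single_le_sum (f := fun a => ∑ b, ((if (a, b) ∈ Ω then (0 : ℝ) else 1) + ℓ) / 2
        * (X a b - Z a b) ^ 2) (fun a _ => Finset.sum_nonneg fun b _ => hn a b) (Finset.mem_univ i))
  rw [residual_apply, mul_pow]
  have h2 := mul_le_mul_of_nonneg_right hw'
    (mul_nonneg (hw i j) (sq_nonneg (X i j - Z i j)))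
  nlinarith

/-- Changing the second argument of the majorizer from `X` to `Z` changes its increments by a
linear term. -/
theorem majorizer_sub_majorizer (W X Z : Matrix (Fin m) (Fin n) ℝ) :
    majorizer Ω Y P ℓ W Z - majorizer Ω Y P ℓ X Z
      = majorizer Ω Y P ℓ W X - objective Ω Y P X
        + ∑ i, ∑ j, (W i j - X i j) * residual Ω ℓ X Z i j := by
  have h : proximity Ω ℓ W Z - proximity Ω ℓ X Z
      = proximity Ω ℓ W X + ∑ i, ∑ j, (W i j - X i j) * residual Ω ℓ X Z i j := by
    simp only [proximity_eq_sum, residual_apply, ← Finset.sum_add_distrib,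
      ← Finset.sum_sub_distrib]
    refine Finset.sum_congr rfl fun i _ => Finset.sum_congr rfl fun j _ => ?_
    ring
  simp only [majorizer_eq]
  linarith

/-- In this form only the residual has to vanish in the limit. The step `X - Z` itself need not: for
`ℓ = 0` its entries in `Ω` are not controlled. -/
theorem IsUpdate.nonneg {X Z : Matrix (Fin m) (Fin n) ℝ} (h : IsUpdate Ω Y P ℓ Z X)
    (W : Matrix (Fin m) (Fin n) ℝ) :
    0 ≤ majorizer Ω Y P ℓ W X - objective Ω Y P X
        + ∑ i, ∑ j, (W i j - X i j) * residual Ω ℓ X Z i j := by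
  rw [← majorizer_sub_majorizer, sub_nonneg]
  exact h (Set.mem_univ W)

theorem antitone_objective (hℓ : 0 ≤ ℓ) {X : ℕ → Matrix (Fin m) (Fin n) ℝ}
    (hX : ∀ k, IsUpdate Ω Y P ℓ (X k) (X (k + 1))) : Antitone fun k => objective Ω Y P (X k) :=
  antitone_nat_of_succ_le fun k => by
    have := proximity_nonneg (Ω := Ω) hℓ (X (k + 1)) (X k)
    linarith [(hX k).objective_add_proximity_le]

/-- If the objective stays bounded below along a subsequence of the iterates, then the residuals
tend to zero. -/
theorem tendsto_residual (hℓ : 0 ≤ ℓ) {X : ℕ → Matrix (Fin m) (Fin n) ℝ}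
    (hX : ∀ k, IsUpdate Ω Y P ℓ (X k) (X (k + 1))) {κ : ℕ → ℕ} (hκ : StrictMono κ) {c : ℝ}
    (hc : ∀ j, c ≤ objective Ω Y P (X (κ j))) (a : Fin m) (b : Fin n) :
    Tendsto (fun k => residual Ω ℓ (X (k + 1)) (X k) a b) atTop (𝓝 0) := by
  have hdesc := fun k => (hX k).objective_add_proximity_le
  have hanti := antitone_objective hℓ hX
  have hbdd : BddBelow (Set.range fun k => objective Ω Y P (X k)) := by
    refine ⟨c, ?_⟩
    rintro _ ⟨k, rfl⟩
    -- Monotonicity and `k ≤ κ k` carry the lower bound from the subsequence to the whole sequence.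
    exact (hc k).trans (hanti (hκ.id_le k))
  have hlim := tendsto_atTop_ciInf hanti hbdd
  have hdiff := hlim.sub (hlim.comp (tendsto_add_atTop_nat 1))
  rw [sub_self] at hdiff
  have hsq : Tendsto (fun k => residual Ω ℓ (X (k + 1)) (X k) a b ^ 2) atTop (𝓝 0) := by
    refine squeeze_zero (fun k => sq_nonneg _) (fun k => ?_)
      (by simpa using hdiff.const_mul (2 * (1 + ℓ)))
    refine (residual_sq_le hℓ _ _ a b).trans
      (mul_le_mul_of_nonneg_left ?_ (by linarith))
    linarith [hdesc k]
  rw [tendsto_zero_iff_abs_tendsto_zero]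
  have := hsq.sqrt
  simpa [Real.sqrt_sq_eq_abs, Function.comp_def] using this

theorem continuous_frobSq : Continuous fun A : Matrix (Fin m) (Fin n) ℝ => frobSq A := by
  unfold frobSq
  fun_prop

theorem continuous_proj : Continuous fun A : Matrix (Fin m) (Fin n) ℝ => proj Ω A := by
  refine continuous_matrix fun i j => ?_
  by_cases h : (i, j) ∈ Ω
  · simpa [proj, h] using continuous_id.matrix_elem i j
  · simpa [proj, h] using continuous_const

theorem continuous_majorizer (W : Matrix (Fin m) (Fin n) ℝ) :
    Continuous fun X => majorizer Ω Y P ℓ W X := by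
  have h1 : Continuous fun X : Matrix (Fin m) (Fin n) ℝ => W - X := by fun_prop
  have h2 := continuous_frobSq.comp h1
  have h3 := continuous_frobSq.comp (h1.sub (continuous_proj (Ω := Ω) |>.comp h1))
  unfold majorizer
  exact (((continuous_const).add (h3.div_const 2)).add (h2.const_mul _)).add continuous_const

theorem objective_of_factorization {q : ℕ} {U : Matrix (Fin m) (Fin q) ℝ}
    {V : Matrix (Fin n) (Fin q) ℝ} (hU : U.transpose * U = 1) (hV : V.transpose * V = 1)
    {s : Fin q → ℝ} (hs : ∀ k, 0 ≤ s k) :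
    objective Ω Y P (U * Matrix.diagonal s * V.transpose)
      = frobSq (proj Ω (U * Matrix.diagonal s * V.transpose - Y)) / 2
        + ((min m n : ℕ) * P 0 + ∑ k, (P (s k) - P 0)) := by
  rw [objective, spectralPenalty_of_factorization P hU hV hs]

theorem factorization_apply {r : ℕ} (u : Matrix (Fin m) (Fin r) ℝ) (v : Matrix (Fin n) (Fin r) ℝ)
    (s : Fin r → ℝ) (a : Fin m) (b : Fin n) :
    (u * Matrix.diagonal s * v.transpose) a b = ∑ k, u a k * s k * v b k := by
  rw [Matrix.mul_apply]
  simp only [Matrix.mul_diagonal, Matrix.transpose_apply]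

theorem tendsto_factorization {r : ℕ} {u : ℕ → Matrix (Fin m) (Fin r) ℝ}
    {v : ℕ → Matrix (Fin n) (Fin r) ℝ} {s : ℕ → Fin r → ℝ} {ub : Matrix (Fin m) (Fin r) ℝ}
    {vb : Matrix (Fin n) (Fin r) ℝ} {sb : Fin r → ℝ} (hu : Tendsto u atTop (𝓝 ub))
    (hv : Tendsto v atTop (𝓝 vb)) (hsb : Tendsto s atTop (𝓝 sb)) :
    Tendsto (fun j => u j * Matrix.diagonal (s j) * (v j).transpose) atTop
      (𝓝 (ub * Matrix.diagonal sb * vb.transpose)) := by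
  refine tendsto_pi_nhds.2 fun a => tendsto_pi_nhds.2 fun b => ?_
  simp only [factorization_apply]
  exact tendsto_finsetSum _ fun k _ =>
    (((tendsto_pi_nhds.1 (tendsto_pi_nhds.1 hu a) k).mul (tendsto_pi_nhds.1 hsb k)).mul
      (tendsto_pi_nhds.1 (tendsto_pi_nhds.1 hv b) k))

/-- The limit of updates whose residuals vanish is an update of itself, hence stationary. -/
theorem isFirstOrderStationary_of_tendsto {r : ℕ} (hP : ContinuousOn P (Set.Ici 0))
    {u : ℕ → Matrix (Fin m) (Fin r) ℝ} {v : ℕ → Matrix (Fin n) (Fin r) ℝ} {s : ℕ → Fin r → ℝ}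
    {Z : ℕ → Matrix (Fin m) (Fin n) ℝ}
    (huo : ∀ j, (u j).transpose * u j = 1) (hvo : ∀ j, (v j).transpose * v j = 1)
    (hs : ∀ j k, 0 ≤ s j k)
    (hupd : ∀ᶠ j in atTop, IsUpdate Ω Y P ℓ (Z j) (u j * Matrix.diagonal (s j) * (v j).transpose))
    (hres : ∀ a b, Tendsto (fun j => residual Ω ℓ (u j * Matrix.diagonal (s j) * (v j).transpose)
      (Z j) a b) atTop (𝓝 0))
    {ub : Matrix (Fin m) (Fin r) ℝ} {vb : Matrix (Fin n) (Fin r) ℝ} {sb : Fin r → ℝ}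
    (hu : Tendsto u atTop (𝓝 ub)) (hv : Tendsto v atTop (𝓝 vb)) (hsb : Tendsto s atTop (𝓝 sb)) :
    IsFirstOrderStationary Ω Y P ℓ (ub * Matrix.diagonal sb * vb.transpose) := by
  have hXlim := tendsto_factorization hu hv hsb
  have hubo : ub.transpose * ub = 1 := by
    have h : Continuous fun A : Matrix (Fin m) (Fin r) ℝ => A.transpose * A := by fun_prop
    exact tendsto_nhds_unique ((h.tendsto ub).comp hu)
      (by simp only [Function.comp_def, huo]; exact tendsto_const_nhds)
  have hvbo : vb.transpose * vb = 1 := by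
    have h : Continuous fun A : Matrix (Fin n) (Fin r) ℝ => A.transpose * A := by fun_prop
    exact tendsto_nhds_unique ((h.tendsto vb).comp hv)
      (by simp only [Function.comp_def, hvo]; exact tendsto_const_nhds)
  have hslim : ∀ k, Tendsto (fun j => s j k) atTop (𝓝 (sb k)) := fun k =>
    (tendsto_pi_nhds.1 hsb) k
  have hsb0 : ∀ k, 0 ≤ sb k := fun k => ge_of_tendsto' (hslim k) fun j => hs j k
  have hobj : Tendsto (fun j => objective Ω Y P (u j * Matrix.diagonal (s j) * (v j).transpose))
      atTop (𝓝 (objective Ω Y P (ub * Matrix.diagonal sb * vb.transpose))) := by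
    rw [objective_of_factorization hubo hvbo hsb0]
    simp only [fun j => objective_of_factorization (Ω := Ω) (Y := Y) (P := P) (huo j) (hvo j) (hs j)]
    refine Tendsto.add (Tendsto.div_const ?_ 2) (tendsto_const_nhds.add
      (tendsto_finsetSum _ fun k _ => Tendsto.sub_const ?_ _))
    · have hc : Continuous fun A : Matrix (Fin m) (Fin n) ℝ => frobSq (proj Ω (A - Y)) :=
        continuous_frobSq.comp (continuous_proj.comp (continuous_id.sub continuous_const))
      exact (hc.tendsto _).comp hXlim
    · exact (hP (sb k) (hsb0 k)).tendsto.comp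
        (tendsto_nhdsWithin_iff.2 ⟨hslim k, Eventually.of_forall fun j => hs j k⟩)
  -- The limit serves as its own successor, which makes the progress measure trivially zero.
  refine ⟨ub * Matrix.diagonal sb * vb.transpose, ?_, ?_⟩
  · intro W _
    set Xb := ub * Matrix.diagonal sb * vb.transpose with hXb
    have hlim := (((continuous_majorizer (Ω := Ω) (Y := Y) (P := P) (ℓ := ℓ) W).tendsto Xb).comp
      hXlim).sub hobj |>.add
      (tendsto_finsetSum Finset.univ fun a (_ : a ∈ Finset.univ) =>
        tendsto_finsetSum Finset.univ fun b (_ : b ∈ Finset.univ) =>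
          (tendsto_const_nhds (x := W a b)).sub
            (((continuous_id.matrix_elem a b).tendsto Xb).comp hXlim) |>.mul (hres a b))
    have h0 := ge_of_tendsto hlim (hupd.mono fun j hj => hj.nonneg W)
    simp only [mul_zero, Finset.sum_const_zero, add_zero, sub_nonneg] at h0
    simpa [majorizer_eq, proximity_self] using h0
  · simp [progress, projPerp, proj, frobSq]

end NCImpute

end

/-! ### Optimality in the singular values and their boundedness -/

noncomputable section

namespace NCImpute

variable {m n r : ℕ} {Ω : Finset (Fin m × Fin n)} {Y : Matrix (Fin m) (Fin n) ℝ} {P : ℝ → ℝ} {ℓ : ℝ}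

theorem factorization_update_apply (u : Matrix (Fin m) (Fin r) ℝ) (v : Matrix (Fin n) (Fin r) ℝ)
    (s : Fin r → ℝ) (k : Fin r) (x : ℝ) (a : Fin m) (b : Fin n) :
    (u * Matrix.diagonal (Function.update s k x) * v.transpose) a b
      = (u * Matrix.diagonal s * v.transpose) a b + (x - s k) * (u a k * v b k) := by
  simp only [factorization_apply]
  rw [← sub_eq_iff_eq_add', ← Finset.sum_sub_distrib, Finset.sum_eq_single k]
  · simp; ring
  · intro c _ hc
    simp [hc]
  · simp

theorem majorizer_sub_eq_sum (X Z : Matrix (Fin m) (Fin n) ℝ) :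
    majorizer Ω Y P ℓ X Z - spectralPenalty P X
      = ∑ a, ∑ b, ((if (a, b) ∈ Ω then (1 : ℝ) else 0) / 2 * (X a b - Y a b) ^ 2
        + ((if (a, b) ∈ Ω then 0 else 1) + ℓ) / 2 * (X a b - Z a b) ^ 2) := by
  rw [majorizer_eq, proximity_eq_sum, objective, frobSq]
  simp only [Finset.sum_add_distrib, Finset.sum_div]
  have h : ∀ a b, proj Ω (X - Y) a b ^ 2 / 2
      = (if (a, b) ∈ Ω then (1 : ℝ) else 0) / 2 * (X a b - Y a b) ^ 2 := fun a b => by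
    by_cases h : (a, b) ∈ Ω <;> simp [proj, h] ; ring
  simp only [h]
  ring

/-- The optimality condition of an update in the direction of one of its singular values. -/
theorem IsUpdate.stationarity {u : Matrix (Fin m) (Fin r) ℝ} {v : Matrix (Fin n) (Fin r) ℝ}
    {s : Fin r → ℝ} {Z : Matrix (Fin m) (Fin n) ℝ}
    (hPdiff : ∀ x, 0 < x → DifferentiableAt ℝ P x)
    (hu : u.transpose * u = 1) (hv : v.transpose * v = 1) (hs : ∀ k, 0 < s k)
    (h : IsUpdate Ω Y P ℓ Z (u * Matrix.diagonal s * v.transpose)) (k : Fin r) :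
    deriv P (s k) = -∑ a, ∑ b, (proj Ω (u * Matrix.diagonal s * v.transpose - Y) a b
      + residual Ω ℓ (u * Matrix.diagonal s * v.transpose) Z a b) * (u a k * v b k) := by
  set X := u * Matrix.diagonal s * v.transpose with hX
  set φ : ℝ → ℝ := fun x => ∑ a, ∑ b,
      ((if (a, b) ∈ Ω then (1 : ℝ) else 0) / 2
          * (X a b + (x - s k) * (u a k * v b k) - Y a b) ^ 2
        + ((if (a, b) ∈ Ω then 0 else 1) + ℓ) / 2
          * (X a b + (x - s k) * (u a k * v b k) - Z a b) ^ 2) with hφ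
  have hpen : ∀ x, 0 < x → spectralPenalty P (u * Matrix.diagonal (Function.update s k x)
      * v.transpose) = spectralPenalty P X + (P x - P (s k)) := by
    intro x hx
    rw [hX, spectralPenalty_of_factorization P hu hv fun i => (hs i).le,
      spectralPenalty_of_factorization P hu hv fun i => ?_]
    · rw [add_assoc, add_right_inj, ← sub_eq_iff_eq_add', ← Finset.sum_sub_distrib,
        Finset.sum_eq_single k]
      · simp
      · intro c _ hc
        simp [hc]
      · simp
    · by_cases hik : i = k
      · subst hik
        simpa using hx.le
      · simpa [hik] using (hs i).le
  have hmaj : ∀ x, 0 < x → majorizer Ω Y P ℓ (u * Matrix.diagonal (Function.update s k x)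
      * v.transpose) Z = φ x + P x + (spectralPenalty P X - P (s k)) := by
    intro x hx
    have h1 := majorizer_sub_eq_sum (Ω := Ω) (Y := Y) (P := P) (ℓ := ℓ)
      (u * Matrix.diagonal (Function.update s k x) * v.transpose) Z
    simp only [factorization_update_apply, hpen x hx] at h1
    simp only [hφ]
    linarith
  have hmin : IsLocalMin (fun x => φ x + P x) (s k) := by
    -- Competitors keep the singular vectors and change only the `k`-th value to some `x > 0`, near
    -- `s k`.
    filter_upwards [lt_mem_nhds (hs k)] with x hx
    have h1 := h (Set.mem_univ (u * Matrix.diagonal (Function.update s k x) * v.transpose))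
    have h2 := hmaj (s k) (hs k)
    rw [Function.update_eq_self, ← hX] at h2
    simp only [Set.mem_ofPred_eq, h2, hmaj x hx] at h1
    linarith
  have hφ' : HasDerivAt φ (∑ a, ∑ b, (proj Ω (X - Y) a b + residual Ω ℓ X Z a b)
      * (u a k * v b k)) (s k) := by
    refine HasDerivAt.fun_sum fun a _ => HasDerivAt.fun_sum fun b _ => ?_
    have hlin : ∀ c : ℝ, HasDerivAt (fun x => X a b + (x - s k) * (u a k * v b k) - c)
        (1 * (u a k * v b k)) (s k) := fun c =>
      ((((hasDerivAt_id (s k)).sub_const (s k)).mul_const _).const_add _).sub_const c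
    refine ((((hlin (Y a b)).pow 2).const_mul _).add (((hlin (Z a b)).pow 2).const_mul _)).congr_deriv
      ?_
    rw [residual_apply]
    by_cases hab : (a, b) ∈ Ω <;> simp [proj, hab] <;> ring
  have h0 := hmin.hasDerivAt_eq_zero (hφ'.add (hPdiff _ (hs k)).hasDerivAt)
  linarith

theorem neg_mul_le_sub_of_derivWithin_bound (hPdiff : DifferentiableOn ℝ P (Set.Ici 0)) {M : ℝ}
    (hM : ∀ x, 0 ≤ x → |derivWithin P (Set.Ici 0) x| ≤ M) {x : ℝ} (hx : 0 ≤ x) :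
    -(M * x) ≤ P x - P 0 := by
  have h := (convex_Ici (0 : ℝ)).norm_image_sub_le_of_norm_derivWithin_le hPdiff
    (fun y hy => hM y hy) (Set.mem_Ici.2 le_rfl) (Set.mem_Ici.2 hx)
  rw [sub_zero, Real.norm_eq_abs, Real.norm_eq_abs, abs_of_nonneg hx] at h
  exact (abs_le.1 h).1

theorem phi_nonpos (hPconc : ConcaveOn ℝ (Set.Ici 0) P)
    (hPdiff : ∀ x, 0 < x → DifferentiableAt ℝ P x) : phi P ≤ 0 := by
  have h1 : phi P ≤ (((deriv P 1 - deriv P 2) / (1 - 2) : ℝ) : EReal) :=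
    (iInf_le_of_le 1 <| iInf_le_of_le 2 <| iInf_le_of_le one_pos <| iInf_le_of_le two_pos <|
      iInf_le _ (by norm_num))
  refine h1.trans ?_
  have hanti := (hPconc.subset Set.Ioi_subset_Ici_self (convex_Ioi 0)).antitoneOn_deriv
    (fun x hx => hPdiff x hx) (a := 1) (b := 2) (by simp) (by simp) one_le_two
  exact_mod_cast div_nonpos_of_nonneg_of_nonpos (sub_nonneg.2 hanti) (by norm_num)

/-- Multiplying the difference quotient by `(x - y) ^ 2` yields an inequality free of division,
which survives limits even when `x - y` tends to zero. -/
theorem mul_sq_le_of_phi_eq {c : ℝ} (hc : phi P = c) {x y : ℝ} (hx : 0 < x) (hy : 0 < y) :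
    c * (x - y) ^ 2 ≤ (deriv P x - deriv P y) * (x - y) := by
  rcases eq_or_ne x y with rfl | hxy
  · simp
  have h1 : phi P ≤ (((deriv P x - deriv P y) / (x - y) : ℝ) : EReal) :=
    (iInf_le_of_le x <| iInf_le_of_le y <| iInf_le_of_le hx <| iInf_le_of_le hy <|
      iInf_le _ hxy)
  rw [hc, EReal.coe_le_coe_iff] at h1
  have h2 := mul_le_mul_of_nonneg_right h1 (sq_nonneg (x - y))
  have h3 : (deriv P x - deriv P y) / (x - y) * (x - y) ^ 2
      = (deriv P x - deriv P y) * (x - y) := by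
    field_simp [sub_ne_zero.2 hxy]
  linarith

theorem Theta_mulVec (u : Matrix (Fin m) (Fin r) ℝ) (v : Matrix (Fin n) (Fin r) ℝ)
    (s : Fin r → ℝ) (p : Fin n × Fin m) :
    (Theta Ω u v).mulVec s p = proj Ω (u * Matrix.diagonal s * v.transpose) p.2 p.1 := by
  simp only [Matrix.mulVec, dotProduct, Theta, Matrix.of_apply, Matrix.vec, proj,
    factorization_apply, Matrix.vecMulVec_apply, Matrix.col_apply]
  by_cases h : (p.2, p.1) ∈ Ω
  · simp only [h, if_true]
    exact Finset.sum_congr rfl fun k _ => by ring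
  · simp [h]

theorem sum_sq_Theta_mulVec (u : Matrix (Fin m) (Fin r) ℝ) (v : Matrix (Fin n) (Fin r) ℝ)
    (s : Fin r → ℝ) :
    ∑ p, (Theta Ω u v).mulVec s p ^ 2
      = frobSq (proj Ω (u * Matrix.diagonal s * v.transpose)) := by
  simp only [Theta_mulVec, frobSq, Fintype.sum_prod_type]
  exact Finset.sum_comm

theorem tendsto_Theta {u : ℕ → Matrix (Fin m) (Fin r) ℝ} {v : ℕ → Matrix (Fin n) (Fin r) ℝ}
    {ub : Matrix (Fin m) (Fin r) ℝ} {vb : Matrix (Fin n) (Fin r) ℝ}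
    (hu : Tendsto u atTop (𝓝 ub)) (hv : Tendsto v atTop (𝓝 vb)) :
    Tendsto (fun j => Theta Ω (u j) (v j)) atTop (𝓝 (Theta Ω ub vb)) := by
  refine tendsto_pi_nhds.2 fun p => tendsto_pi_nhds.2 fun k => ?_
  simp only [Theta, Matrix.of_apply, Matrix.vec, proj, Matrix.vecMulVec_apply, Matrix.col_apply]
  by_cases h : (p.2, p.1) ∈ Ω
  · simp only [h, if_true]
    exact (tendsto_pi_nhds.1 (tendsto_pi_nhds.1 hu p.2) k).mul
      (tendsto_pi_nhds.1 (tendsto_pi_nhds.1 hv p.1) k)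
  · simp [h]

/-- Matrices converging to an injective one are eventually uniformly bounded below. -/
theorem eventually_norm_le_mul_norm_mulVec {ι : Type*} [Fintype ι] {A : ℕ → Matrix ι (Fin r) ℝ}
    {B : Matrix ι (Fin r) ℝ} (hA : Tendsto A atTop (𝓝 B)) (hB : Function.Injective B.mulVec) :
    ∃ K : ℝ, 0 ≤ K ∧ ∀ᶠ j in atTop, ∀ w : Fin r → ℝ, ‖w‖ ≤ K * ‖(A j).mulVec w‖ := by
  obtain ⟨L, hL⟩ := B.mulVecLin.exists_leftInverse_of_injective (LinearMap.ker_eq_bot.2 hB)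
  set C := ‖LinearMap.toContinuousLinearMap L‖ with hC
  have hLC : ∀ x, ‖L x‖ ≤ C * ‖x‖ := (LinearMap.toContinuousLinearMap L).le_opNorm
  have hC0 : 0 ≤ C := norm_nonneg _
  have hδ : Tendsto (fun j => C * ∑ p, ∑ k, |B p k - A j p k|) atTop (𝓝 0) := by
    have h : Tendsto (fun j => C * ∑ p, ∑ k, |B p k - A j p k|) atTop
        (𝓝 (C * ∑ p, ∑ k, |B p k - B p k|)) :=
      (tendsto_finsetSum _ fun p _ => tendsto_finsetSum _ fun k _ => ((tendsto_const_nhds.sub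
        (tendsto_pi_nhds.1 (tendsto_pi_nhds.1 hA p) k)).abs)).const_mul C
    simpa using h
  -- Once the perturbation costs at most `‖w‖ / 2`, absorbing it doubles the constant `C` of the
  -- left inverse.
  refine ⟨2 * C, by positivity, ?_⟩
  filter_upwards [hδ.eventually_le_const (show (0 : ℝ) < 1 / 2 by norm_num)] with j hj w
  have hBw : L (B.mulVec w) = w := LinearMap.congr_fun hL w
  have hdiff : ‖(B - A j).mulVec w‖ ≤ (∑ p, ∑ k, |B p k - A j p k|) * ‖w‖ := by
    refine (pi_norm_le_iff_of_nonneg (by positivity)).2 fun p => ?_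
    calc ‖(B - A j).mulVec w p‖ ≤ ∑ k, |B p k - A j p k| * ‖w‖ := by
          refine (norm_sum_le Finset.univ fun k => (B - A j) p k * w k).trans
            (Finset.sum_le_sum fun k _ => ?_)
          rw [norm_mul]
          exact mul_le_mul_of_nonneg_left (norm_le_pi_norm w k) (norm_nonneg _)
      _ = (∑ k, |B p k - A j p k|) * ‖w‖ := (Finset.sum_mul _ _ _).symm
      _ ≤ _ := mul_le_mul_of_nonneg_right (Finset.single_le_sum
          (f := fun p => ∑ k, |B p k - A j p k|)
          (fun _ _ => Finset.sum_nonneg fun _ _ => abs_nonneg _) (Finset.mem_univ p))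
          (norm_nonneg _)
  have h1 : ‖w‖ ≤ C * ‖B.mulVec w‖ := by
    have := hLC (B.mulVec w)
    rwa [hBw] at this
  have h2 : ‖B.mulVec w‖ ≤ ‖(A j).mulVec w‖ + ‖(B - A j).mulVec w‖ := by
    have : B.mulVec w = (A j).mulVec w + (B - A j).mulVec w := by
      rw [← Matrix.add_mulVec, add_sub_cancel]
    rw [this]
    exact norm_add_le _ _
  have h3 := mul_le_mul_of_nonneg_left (h2.trans (add_le_add le_rfl hdiff)) hC0
  have h4 := mul_le_mul_of_nonneg_right hj (norm_nonneg w)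
  nlinarith

/-- Along factors for which `Θ` converges to an injective matrix, the singular values stay bounded
if the objective does. -/
theorem eventually_norm_le_of_objective_le (hPdiff : DifferentiableOn ℝ P (Set.Ici 0)) {M : ℝ}
    (hM : ∀ x, 0 ≤ x → |derivWithin P (Set.Ici 0) x| ≤ M)
    {u : ℕ → Matrix (Fin m) (Fin r) ℝ} {v : ℕ → Matrix (Fin n) (Fin r) ℝ} {s : ℕ → Fin r → ℝ}
    (huo : ∀ j, (u j).transpose * u j = 1) (hvo : ∀ j, (v j).transpose * v j = 1)
    (hs : ∀ j k, 0 ≤ s j k)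
    {ub : Matrix (Fin m) (Fin r) ℝ} {vb : Matrix (Fin n) (Fin r) ℝ}
    (hu : Tendsto u atTop (𝓝 ub)) (hv : Tendsto v atTop (𝓝 vb))
    (hinj : Function.Injective (Theta Ω ub vb).mulVec) {c : ℝ}
    (hc : ∀ j, objective Ω Y P (u j * Matrix.diagonal (s j) * (v j).transpose) ≤ c) :
    ∃ B : ℝ, ∀ᶠ j in atTop, ‖s j‖ ≤ B := by
  obtain ⟨K, hK0, hK⟩ := eventually_norm_le_mul_norm_mulVec (tendsto_Theta (Ω := Ω) hu hv) hinj
  have hM0 : 0 ≤ M := (abs_nonneg _).trans (hM 0 le_rfl)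
  set α := K ^ 2 * (4 * |c - (min m n : ℕ) * P 0| + 2 * frobSq (proj Ω Y)) with hα
  set β := K ^ 2 * (4 * (r * M)) with hβ
  have hα0 : 0 ≤ α := by
    have := frobSq_nonneg (proj Ω Y)
    positivity
  have hβ0 : 0 ≤ β := by positivity
  -- The estimate below is `t ^ 2 ≤ α + β * t` for `t = ‖s j‖`, which fails for `t > α + β + 1`.
  refine ⟨α + β + 1, ?_⟩
  filter_upwards [hK] with j hj
  set X := u j * Matrix.diagonal (s j) * (v j).transpose with hX
  have h1 : ‖(Theta Ω (u j) (v j)).mulVec (s j)‖ ^ 2 ≤ frobSq (proj Ω X) := by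
    rw [← sum_sq_Theta_mulVec]
    refine (Real.le_sqrt (norm_nonneg _) (Finset.sum_nonneg fun _ _ => sq_nonneg _)).1
      ((pi_norm_le_iff_of_nonneg (Real.sqrt_nonneg _)).2 fun p => ?_)
    rw [Real.norm_eq_abs, ← Real.sqrt_sq_eq_abs]
    exact Real.sqrt_le_sqrt (Finset.single_le_sum
      (f := fun p => (Theta Ω (u j) (v j)).mulVec (s j) p ^ 2) (fun _ _ => sq_nonneg _)
      (Finset.mem_univ p))
  have h2 : frobSq (proj Ω X) ≤ 2 * frobSq (proj Ω (X - Y)) + 2 * frobSq (proj Ω Y) := by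
    simp only [frobSq, Finset.mul_sum, ← Finset.sum_add_distrib]
    refine Finset.sum_le_sum fun a _ => Finset.sum_le_sum fun b _ => ?_
    by_cases hab : (a, b) ∈ Ω
    · simp only [proj, Matrix.of_apply, hab, if_true, Matrix.sub_apply]
      nlinarith [sq_nonneg (X a b - 2 * Y a b)]
    · simp [proj, hab]
  have h3 : frobSq (proj Ω (X - Y)) / 2 ≤ |c - (min m n : ℕ) * P 0| + r * M * ‖s j‖ := by
    have h4 := hc j
    rw [objective_of_factorization (huo j) (hvo j) (hs j)] at h4
    have h5 : -(r * M * ‖s j‖) ≤ ∑ k, (P (s j k) - P 0) := by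
      have h6 : ∑ _k : Fin r, -(M * ‖s j‖) ≤ ∑ k, (P (s j k) - P 0) := by
        refine Finset.sum_le_sum fun k _ => ?_
        refine le_trans ?_ (neg_mul_le_sub_of_derivWithin_bound hPdiff hM (hs j k))
        exact neg_le_neg (mul_le_mul_of_nonneg_left
          ((le_abs_self _).trans (norm_le_pi_norm (s j) k)) hM0)
      refine le_trans (le_of_eq ?_) h6
      simp
      ring
    linarith [le_abs_self (c - (min m n : ℕ) * P 0)]
  have h7 : ‖s j‖ ^ 2 ≤ α + β * ‖s j‖ := by
    calc ‖s j‖ ^ 2 ≤ (K * ‖(Theta Ω (u j) (v j)).mulVec (s j)‖) ^ 2 :=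
          pow_le_pow_left₀ (norm_nonneg _) (hj (s j)) 2
      _ = K ^ 2 * ‖(Theta Ω (u j) (v j)).mulVec (s j)‖ ^ 2 := by ring
      _ ≤ K ^ 2 * (4 * (|c - (min m n : ℕ) * P 0| + r * M * ‖s j‖) + 2 * frobSq (proj Ω Y)) :=
          mul_le_mul_of_nonneg_left (by linarith) (sq_nonneg K)
      _ = α + β * ‖s j‖ := by rw [hα, hβ]; ring
  by_contra! hlt
  nlinarith [norm_nonneg (s j)]

end NCImpute

end

/-! ### Limits along subsequences and comparison of two limits -/

noncomputable section

namespace NCImpute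

variable {m n r : ℕ} {Ω : Finset (Fin m × Fin n)} {Y : Matrix (Fin m) (Fin n) ℝ} {P : ℝ → ℝ} {ℓ : ℝ}

theorem IsReducedSVD.cast {A : Matrix (Fin m) (Fin n) ℝ} {q : ℕ} {U : Matrix (Fin m) (Fin q) ℝ}
    {s : Fin q → ℝ} {V : Matrix (Fin n) (Fin q) ℝ} (h : IsReducedSVD A U s V) (hq : r = q) :
    IsReducedSVD A (U.submatrix id (Fin.cast hq)) (s ∘ Fin.cast hq)
      (V.submatrix id (Fin.cast hq)) := by
  subst hq
  exact h

/-- Along a subsequence of the iterates with bounded singular values, the residuals vanish. -/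
theorem tendsto_residual_comp (hPdiff : DifferentiableOn ℝ P (Set.Ici 0)) {M : ℝ}
    (hM : ∀ x, 0 ≤ x → |derivWithin P (Set.Ici 0) x| ≤ M) (hℓ : 0 ≤ ℓ)
    {X : ℕ → Matrix (Fin m) (Fin n) ℝ} (hX : ∀ k, IsUpdate Ω Y P ℓ (X k) (X (k + 1)))
    {κ : ℕ → ℕ} (hκ : StrictMono κ)
    {u : ℕ → Matrix (Fin m) (Fin r) ℝ} {v : ℕ → Matrix (Fin n) (Fin r) ℝ} {s : ℕ → Fin r → ℝ}
    (hsvd : ∀ j, IsReducedSVD (X (κ j)) (u j) (s j) (v j)) {B : ℝ} (hB : ∀ᶠ j in atTop, ‖s j‖ ≤ B)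
    (a : Fin m) (b : Fin n) :
    Tendsto (fun j => residual Ω ℓ (X (κ j)) (X (κ j - 1)) a b) atTop (𝓝 0) := by
  have hM0 : 0 ≤ M := (abs_nonneg _).trans (hM 0 le_rfl)
  obtain ⟨N, hN⟩ := eventually_atTop.1 hB
  have hlow : ∀ j, (min m n : ℕ) * P 0 + ∑ _k : Fin r, -(M * B)
      ≤ objective Ω Y P (X (κ (j + N))) := by
    intro j
    have h := hsvd (j + N)
    rw [h.eq, objective_of_factorization h.orthoU h.orthoV fun k => (h.pos k).le]
    refine (add_le_add le_rfl (Finset.sum_le_sum fun k _ => ?_)).trans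
      (le_add_of_nonneg_left (div_nonneg (frobSq_nonneg _) two_pos.le))
    refine le_trans ?_ (neg_mul_le_sub_of_derivWithin_bound hPdiff hM (h.pos k).le)
    exact neg_le_neg (mul_le_mul_of_nonneg_left (((le_abs_self _).trans
      (norm_le_pi_norm (s (j + N)) k)).trans (hN _ (Nat.le_add_left N j))) hM0)
  have hlim := tendsto_residual hℓ hX (hκ.comp (strictMono_id.add_const N)) hlow a b
  refine (hlim.comp ((tendsto_sub_atTop_nat 1).comp hκ.tendsto_atTop)).congr' ?_
  -- The truncated `κ j - 1` is a true predecessor only when `κ j ≥ 1`, which holds eventually.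
  filter_upwards [hκ.tendsto_atTop.eventually_ge_atTop 1] with j hj
  simp [Nat.sub_add_cancel hj]

theorem isFirstOrderStationary_of_subseq (hPdiff : DifferentiableOn ℝ P (Set.Ici 0))
    {X : ℕ → Matrix (Fin m) (Fin n) ℝ} (hX : ∀ k, IsUpdate Ω Y P ℓ (X k) (X (k + 1)))
    {κ : ℕ → ℕ} (hκ : StrictMono κ)
    {u : ℕ → Matrix (Fin m) (Fin r) ℝ} {v : ℕ → Matrix (Fin n) (Fin r) ℝ} {s : ℕ → Fin r → ℝ}
    (hsvd : ∀ j, IsReducedSVD (X (κ j)) (u j) (s j) (v j))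
    (hres : ∀ a b, Tendsto (fun j => residual Ω ℓ (X (κ j)) (X (κ j - 1)) a b) atTop (𝓝 0))
    {ub : Matrix (Fin m) (Fin r) ℝ} {vb : Matrix (Fin n) (Fin r) ℝ} {sb : Fin r → ℝ}
    (hu : Tendsto u atTop (𝓝 ub)) (hv : Tendsto v atTop (𝓝 vb)) {ψ : ℕ → ℕ} (hψ : StrictMono ψ)
    (hsb : Tendsto (s ∘ ψ) atTop (𝓝 sb)) :
    IsFirstOrderStationary Ω Y P ℓ (ub * Matrix.diagonal sb * vb.transpose) := by
  refine isFirstOrderStationary_of_tendsto (u := u ∘ ψ) (v := v ∘ ψ) (s := s ∘ ψ)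
    (Z := fun j => X (κ (ψ j) - 1)) hPdiff.continuousOn (fun j => (hsvd (ψ j)).orthoU)
    (fun j => (hsvd (ψ j)).orthoV) (fun j k => ((hsvd (ψ j)).pos k).le) ?_ (fun a b => ?_)
    (hu.comp hψ.tendsto_atTop) (hv.comp hψ.tendsto_atTop) hsb
  · filter_upwards [(hκ.comp hψ).tendsto_atTop.eventually_ge_atTop 1] with j hj
    simp only [Function.comp_apply] at hj
    have h := hX (κ (ψ j) - 1)
    rw [Nat.sub_add_cancel hj, (hsvd (ψ j)).eq] at h
    exact h
  · refine ((hres a b).comp hψ.tendsto_atTop).congr fun j => ?_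
    simp only [Function.comp_apply]
    rw [← (hsvd (ψ j)).eq]

/-- The limit of the optimality conditions of the singular values. -/
theorem tendsto_deriv (hPdiff : ∀ x, 0 < x → DifferentiableAt ℝ P x)
    {X : ℕ → Matrix (Fin m) (Fin n) ℝ} (hX : ∀ k, IsUpdate Ω Y P ℓ (X k) (X (k + 1)))
    {κ : ℕ → ℕ} (hκ : StrictMono κ)
    {u : ℕ → Matrix (Fin m) (Fin r) ℝ} {v : ℕ → Matrix (Fin n) (Fin r) ℝ} {s : ℕ → Fin r → ℝ}
    (hsvd : ∀ j, IsReducedSVD (X (κ j)) (u j) (s j) (v j))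
    (hres : ∀ a b, Tendsto (fun j => residual Ω ℓ (X (κ j)) (X (κ j - 1)) a b) atTop (𝓝 0))
    {ub : Matrix (Fin m) (Fin r) ℝ} {vb : Matrix (Fin n) (Fin r) ℝ} {sb : Fin r → ℝ}
    (hu : Tendsto u atTop (𝓝 ub)) (hv : Tendsto v atTop (𝓝 vb)) {ψ : ℕ → ℕ} (hψ : StrictMono ψ)
    (hsb : Tendsto (s ∘ ψ) atTop (𝓝 sb)) (k : Fin r) :
    Tendsto (fun j => deriv P (s (ψ j) k)) atTop
      (𝓝 (-∑ a, ∑ b, proj Ω (ub * Matrix.diagonal sb * vb.transpose - Y) a b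
        * (ub a k * vb b k))) := by
  have hXlim : Tendsto (fun j => X (κ (ψ j))) atTop
      (𝓝 (ub * Matrix.diagonal sb * vb.transpose)) :=
    (tendsto_factorization (hu.comp hψ.tendsto_atTop) (hv.comp hψ.tendsto_atTop) hsb).congr
      fun j => ((hsvd (ψ j)).eq).symm
  have hproj : Tendsto (fun j => proj Ω (X (κ (ψ j)) - Y)) atTop
      (𝓝 (proj Ω (ub * Matrix.diagonal sb * vb.transpose - Y))) :=
    (continuous_proj.tendsto _).comp (hXlim.sub_const Y)
  have hlim : Tendsto (fun j => -∑ a, ∑ b, (proj Ω (X (κ (ψ j)) - Y) a b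
      + residual Ω ℓ (X (κ (ψ j))) (X (κ (ψ j) - 1)) a b) * (u (ψ j) a k * v (ψ j) b k)) atTop
      (𝓝 (-∑ a, ∑ b, (proj Ω (ub * Matrix.diagonal sb * vb.transpose - Y) a b + 0)
        * (ub a k * vb b k))) :=
    (tendsto_finsetSum _ fun a _ => tendsto_finsetSum _ fun b _ =>
      ((tendsto_pi_nhds.1 (tendsto_pi_nhds.1 hproj a) b).add
        ((hres a b).comp hψ.tendsto_atTop)).mul
        ((tendsto_pi_nhds.1 (tendsto_pi_nhds.1 (hu.comp hψ.tendsto_atTop) a) k).mul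
          (tendsto_pi_nhds.1 (tendsto_pi_nhds.1 (hv.comp hψ.tendsto_atTop) b) k))).neg
  simp only [add_zero] at hlim
  refine hlim.congr' ?_
  filter_upwards [(hκ.comp hψ).tendsto_atTop.eventually_ge_atTop 1] with j hj
  simp only [Function.comp_apply] at hj
  have h := hX (κ (ψ j) - 1)
  have hsv := hsvd (ψ j)
  rw [Nat.sub_add_cancel hj, hsv.eq] at h
  rw [h.stationarity hPdiff hsv.orthoU hsv.orthoV hsv.pos k, ← hsv.eq]

/-- Expanding the product gives `⟨P_Ω(A), A⟩` for `A = u diag(w) v'`, and `P_Ω` is an orthogonal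
projection. -/
theorem sum_mul_sum_proj (u : Matrix (Fin m) (Fin r) ℝ) (v : Matrix (Fin n) (Fin r) ℝ)
    (w : Fin r → ℝ) :
    ∑ k, w k * ∑ a, ∑ b, proj Ω (u * Matrix.diagonal w * v.transpose) a b * (u a k * v b k)
      = frobSq (proj Ω (u * Matrix.diagonal w * v.transpose)) := by
  simp only [Finset.mul_sum, frobSq]
  rw [Finset.sum_comm]
  refine Finset.sum_congr rfl fun a _ => ?_
  rw [Finset.sum_comm]
  refine Finset.sum_congr rfl fun b _ => ?_
  have h : proj Ω (u * Matrix.diagonal w * v.transpose) a b ^ 2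
      = proj Ω (u * Matrix.diagonal w * v.transpose) a b
        * (u * Matrix.diagonal w * v.transpose) a b := by
    by_cases hab : (a, b) ∈ Ω <;> simp [proj, hab] ; ring
  rw [h, factorization_apply, Finset.mul_sum]
  exact Finset.sum_congr rfl fun k _ => by ring

/-- Two limits of the singular values satisfy the monotonicity inequality in the limit. -/
theorem frobSq_add_phi_mul_nonpos (hPdiff : ∀ x, 0 < x → DifferentiableAt ℝ P x) {c : ℝ}
    (hc : phi P = c)
    {X : ℕ → Matrix (Fin m) (Fin n) ℝ} (hX : ∀ k, IsUpdate Ω Y P ℓ (X k) (X (k + 1)))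
    {κ : ℕ → ℕ} (hκ : StrictMono κ)
    {u : ℕ → Matrix (Fin m) (Fin r) ℝ} {v : ℕ → Matrix (Fin n) (Fin r) ℝ} {s : ℕ → Fin r → ℝ}
    (hsvd : ∀ j, IsReducedSVD (X (κ j)) (u j) (s j) (v j))
    (hres : ∀ a b, Tendsto (fun j => residual Ω ℓ (X (κ j)) (X (κ j - 1)) a b) atTop (𝓝 0))
    {ub : Matrix (Fin m) (Fin r) ℝ} {vb : Matrix (Fin n) (Fin r) ℝ} {σ τ : Fin r → ℝ}
    (hu : Tendsto u atTop (𝓝 ub)) (hv : Tendsto v atTop (𝓝 vb)) {ψ χ : ℕ → ℕ}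
    (hψ : StrictMono ψ) (hχ : StrictMono χ) (hσ : Tendsto (s ∘ ψ) atTop (𝓝 σ))
    (hτ : Tendsto (s ∘ χ) atTop (𝓝 τ)) :
    frobSq (proj Ω (ub * Matrix.diagonal (σ - τ) * vb.transpose)) + c * ∑ k, (σ k - τ k) ^ 2
      ≤ 0 := by
  have hk : ∀ k, c * (σ k - τ k) ^ 2 ≤ -((σ - τ) k *
      ∑ a, ∑ b, proj Ω (ub * Matrix.diagonal (σ - τ) * vb.transpose) a b * (ub a k * vb b k)) := by
    intro k
    have hdσ := tendsto_deriv hPdiff hX hκ hsvd hres hu hv hψ hσ k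
    have hdτ := tendsto_deriv hPdiff hX hκ hsvd hres hu hv hχ hτ k
    have hsub := (tendsto_pi_nhds.1 hσ k).sub (tendsto_pi_nhds.1 hτ k)
    -- The slope inequality is used at the positive singular values of the iterates, before the
    -- limit, so entries of `σ` and `τ` may be zero.
    have hle := le_of_tendsto_of_tendsto' ((hsub.pow 2).const_mul c) ((hdσ.sub hdτ).mul hsub)
      fun j => mul_sq_le_of_phi_eq hc ((hsvd (ψ j)).pos k) ((hsvd (χ j)).pos k)
    refine hle.trans (le_of_eq ?_)
    have hsplit : ∀ a b, proj Ω (ub * Matrix.diagonal (σ - τ) * vb.transpose) a b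
        = proj Ω (ub * Matrix.diagonal σ * vb.transpose - Y) a b
          - proj Ω (ub * Matrix.diagonal τ * vb.transpose - Y) a b := by
      intro a b
      by_cases hab : (a, b) ∈ Ω
      · simp only [proj, Matrix.of_apply, hab, if_true, Matrix.sub_apply, factorization_apply,
          Pi.sub_apply, mul_sub, sub_mul, Finset.sum_sub_distrib]
        ring
      · simp [proj, hab]
    simp only [hsplit, sub_mul, Finset.sum_sub_distrib, Pi.sub_apply]
    ring
  calc _ = ∑ k, (σ - τ) k * ∑ a, ∑ b, proj Ω (ub * Matrix.diagonal (σ - τ) * vb.transpose) a b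
          * (ub a k * vb b k) + ∑ k, c * (σ k - τ k) ^ 2 := by
        rw [sum_mul_sum_proj, Finset.mul_sum]
    _ ≤ 0 := by
        rw [← Finset.sum_add_distrib]
        exact Finset.sum_nonpos fun k _ => by linarith [hk k]

theorem mulVec_injective_of_rank_eq {ι : Type*} [Fintype ι] {A : Matrix ι (Fin r) ℝ}
    (h : A.rank = r) : Function.Injective A.mulVec := by
  have h1 := A.mulVecLin.finrank_range_add_finrank_ker
  rw [Matrix.rank] at h
  rw [h, Module.finrank_fin_fun, Nat.add_eq_left, Submodule.finrank_eq_zero] at h1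
  exact LinearMap.ker_eq_bot.1 h1

/-- If the least eigenvalue of `A'A` exceeds `-c`, then so do the values of its quadratic form. -/
theorem sum_sq_mulVec_add_pos {ι : Type*} [Fintype ι] {A : Matrix ι (Fin r) ℝ} {c : ℝ}
    (h : 0 < lambdaMin (A.transpose * A) + (c : EReal)) {w : Fin r → ℝ} (hw : w ≠ 0) :
    0 < ∑ p, A.mulVec w p ^ 2 + c * ∑ k, w k ^ 2 := by
  have hH : (A.transpose * A + c • (1 : Matrix (Fin r) (Fin r) ℝ)).IsHermitian := by
    rw [Matrix.IsHermitian, Matrix.conjTranspose_eq_transpose_of_trivial]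
    simp [Matrix.transpose_mul]
  have hpos : (A.transpose * A + c • (1 : Matrix (Fin r) (Fin r) ℝ)).PosDef := by
    refine hH.posDef_iff_eigenvalues_pos.2 fun i => ?_
    have h1 := hH.eigenvalues_mem_spectrum_real i
    -- Adding `c • 1` shifts the spectrum by `c`.
    have h2 : hH.eigenvalues i - c ∈ spectrum ℝ (A.transpose * A) := by
      rw [spectrum.mem_iff] at h1 ⊢
      convert h1 using 2
      rw [map_sub, Algebra.algebraMap_eq_smul_one c]
      abel
    have h3 : lambdaMin (A.transpose * A) ≤ ((hH.eigenvalues i - c : ℝ) : EReal) :=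
      iInf₂_le _ h2
    have h4 := h.trans_le (add_le_add_left h3 (c : EReal))
    have h5 : (0 : ℝ) < hH.eigenvalues i - c + c := by exact_mod_cast h4
    linarith
  have h6 := hpos.dotProduct_mulVec_pos hw
  have h7 : ∑ p, A.mulVec w p ^ 2 = A.mulVec w ⬝ᵥ A.mulVec w := by
    simp [dotProduct, sq]
  have h8 : ∑ k, w k ^ 2 = w ⬝ᵥ w := by
    simp [dotProduct, sq]
  have h9 : w ⬝ᵥ A.transpose.mulVec (A.mulVec w) = A.mulVec w ⬝ᵥ A.mulVec w := by
    rw [Matrix.dotProduct_mulVec, Matrix.vecMul_transpose]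
  rw [h7, h8]
  simp only [star_trivial, Matrix.add_mulVec, dotProduct_add, Matrix.smul_mulVec, Matrix.one_mulVec,
    dotProduct_smul, smul_eq_mul, ← Matrix.mulVec_mulVec, h9] at h6
  exact h6

end NCImpute

end

/-! ### Assembly of the two statements -/

theorem mainTheorem7 {m n : ℕ} (Ω : Finset (Fin m × Fin n)) (Y : Matrix (Fin m) (Fin n) ℝ)
    -- the penalty: concave, differentiable, with bounded derivative on `[0, ∞)`
    (P : ℝ → ℝ) (hPconc : ConcaveOn ℝ (Set.Ici 0) P)
    (hPdiff : DifferentiableOn ℝ P (Set.Ici 0))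
    (hPbdd : ∃ M : ℝ, ∀ x, 0 ≤ x → |derivWithin P (Set.Ici 0) x| ≤ M)
    (ℓ : ℝ) (hℓ : 0 ≤ ℓ)
    -- the iterates
    (X : ℕ → Matrix (Fin m) (Fin n) ℝ)
    (hX : ∀ k, NCImpute.IsUpdate Ω Y P ℓ (X k) (X (k + 1)))
    -- their rank-reduced singular value decompositions
    (q : ℕ → ℕ) (U : ∀ k, Matrix (Fin m) (Fin (q k)) ℝ) (s : ∀ k, Fin (q k) → ℝ)
    (V : ∀ k, Matrix (Fin n) (Fin (q k)) ℝ)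
    (hsvd : ∀ k, NCImpute.IsReducedSVD (X k) (U k) (s k) (V k))
    -- the limit point of the singular vectors along a subsequence
    (r : ℕ) (Ubar : Matrix (Fin m) (Fin r) ℝ) (Vbar : Matrix (Fin n) (Fin r) ℝ)
    (κ : ℕ → ℕ) (hκ : StrictMono κ) (hq : ∀ j, r = q (κ j))
    (hU : Tendsto (fun j => (U (κ j)).submatrix id (Fin.cast (hq j))) atTop (𝓝 Ubar))
    (hV : Tendsto (fun j => (V (κ j)).submatrix id (Fin.cast (hq j))) atTop (𝓝 Vbar)) :
    ((NCImpute.Theta Ω Ubar Vbar).rank = r →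
      ∃ Xbar, MapClusterPt Xbar atTop (fun j => X (κ j)) ∧
        NCImpute.IsFirstOrderStationary Ω Y P ℓ Xbar) ∧
    (0 < NCImpute.lambdaMin
          ((NCImpute.Theta Ω Ubar Vbar).transpose * NCImpute.Theta Ω Ubar Vbar)
          + NCImpute.phi P →
      ∃ sbar : Fin r → ℝ,
        Tendsto (fun j => s (κ j) ∘ Fin.cast (hq j)) atTop (𝓝 sbar) ∧
        Tendsto (fun j => X (κ j)) atTop (𝓝 (Ubar * Matrix.diagonal sbar * Vbar.transpose)) ∧
        NCImpute.IsFirstOrderStationary Ω Y P ℓ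
          (Ubar * Matrix.diagonal sbar * Vbar.transpose)) := by
  obtain ⟨M, hM⟩ := hPbdd
  have hPat : ∀ x, 0 < x → DifferentiableAt ℝ P x := fun x hx =>
    (hPdiff x hx.le).differentiableAt (Ici_mem_nhds hx)
  have hsvd' := fun j => (hsvd (κ j)).cast (hq j)
  have hbound : Function.Injective (NCImpute.Theta Ω Ubar Vbar).mulVec →
      ∃ B : ℝ, ∀ᶠ j in atTop, ‖s (κ j) ∘ Fin.cast (hq j)‖ ≤ B := fun hinj =>
    NCImpute.eventually_norm_le_of_objective_le (Ω := Ω) (Y := Y) hPdiff hM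
      (fun j => (hsvd' j).orthoU) (fun j => (hsvd' j).orthoV) (fun j k => ((hsvd' j).pos k).le)
      hU hV hinj (c := NCImpute.objective Ω Y P (X 0)) fun j => by
        rw [← (hsvd' j).eq]
        exact NCImpute.antitone_objective hℓ hX (Nat.zero_le _)
  constructor
  · intro hrank
    obtain ⟨B, hB⟩ := hbound (NCImpute.mulVec_injective_of_rank_eq hrank)
    have hres := NCImpute.tendsto_residual_comp hPdiff hM hℓ hX hκ hsvd' hB
    obtain ⟨σ, -, ψ, hψ, hσ⟩ := tendsto_subseq_of_frequently_bounded
      (Metric.isBounded_closedBall (x := (0 : Fin r → ℝ)) (r := B))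
      (hB.mono fun j hj => mem_closedBall_zero_iff.2 hj).frequently
    refine ⟨Ubar * Matrix.diagonal σ * Vbar.transpose, ?_,
      NCImpute.isFirstOrderStationary_of_subseq hPdiff hX hκ hsvd' hres hU hV hψ hσ⟩
    have hlim : Tendsto (fun j => X (κ (ψ j))) atTop
        (𝓝 (Ubar * Matrix.diagonal σ * Vbar.transpose)) :=
      (NCImpute.tendsto_factorization (hU.comp hψ.tendsto_atTop) (hV.comp hψ.tendsto_atTop)
        hσ).congr fun j => ((hsvd' (ψ j)).eq).symm
    exact hlim.mapClusterPt.of_comp hψ.tendsto_atTop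
  · intro hpos
    obtain ⟨c, hc⟩ : ∃ c : ℝ, NCImpute.phi P = c := by
      have hle := NCImpute.phi_nonpos hPconc hPat
      refine ⟨(NCImpute.phi P).toReal, (EReal.coe_toReal ?_ ?_).symm⟩
      · exact (hle.trans_lt EReal.zero_lt_top).ne
      -- In `EReal` adding `⊥` gives `⊥`, even to `⊤`, so positivity of the sum excludes `φ_P = -∞`
      -- also for `r = 0`.
      · intro hbot
        simp [hbot] at hpos
    have hc0 : c ≤ 0 := by
      have hle := NCImpute.phi_nonpos hPconc hPat
      rw [hc] at hle
      exact_mod_cast hle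
    rw [hc] at hpos
    have hquad := fun w hw => NCImpute.sum_sq_mulVec_add_pos hpos (w := w) hw
    -- On a nonzero kernel vector the positive form would reduce to `c * ∑ k, w k ^ 2`, which is
    -- nonpositive.
    have hinj : Function.Injective (NCImpute.Theta Ω Ubar Vbar).mulVec := by
      refine (injective_iff_map_eq_zero (NCImpute.Theta Ω Ubar Vbar).mulVecLin).2 fun w hw => ?_
      by_contra hw0
      have h1 := hquad w hw0
      rw [Matrix.mulVecLin_apply] at hw
      have h2 : c * ∑ k, w k ^ 2 ≤ 0 :=
        mul_nonpos_of_nonpos_of_nonneg hc0 (Finset.sum_nonneg fun _ _ => sq_nonneg _)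
      simp only [hw, Pi.zero_apply] at h1
      norm_num at h1
      linarith
    obtain ⟨B, hB⟩ := hbound hinj
    have hres := NCImpute.tendsto_residual_comp hPdiff hM hℓ hX hκ hsvd' hB
    obtain ⟨σ, -, ψ, hψ, hσ⟩ := tendsto_subseq_of_frequently_bounded
      (Metric.isBounded_closedBall (x := (0 : Fin r → ℝ)) (r := B))
      (hB.mono fun j hj => mem_closedBall_zero_iff.2 hj).frequently
    have hlim : Tendsto (fun j => s (κ j) ∘ Fin.cast (hq j)) atTop (𝓝 σ) := by
      -- A sequence eventually in a compact set converges once it has a single cluster point; a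
      -- second one, `τ`, is compared with `σ`.
      refine (isCompact_closedBall (0 : Fin r → ℝ) B).tendsto_nhds_of_unique_mapClusterPt
        (hB.mono fun j hj => mem_closedBall_zero_iff.2 hj) fun τ _ hτ => ?_
      obtain ⟨χ, hχ, hτ⟩ := MapClusterPt.tendsto_subseq hτ
      by_contra hne
      have h1 := NCImpute.frobSq_add_phi_mul_nonpos hPat hc hX hκ hsvd' hres hU hV hχ hψ hτ hσ
      have h2 := hquad (τ - σ) (sub_ne_zero.2 hne)
      rw [NCImpute.sum_sq_Theta_mulVec] at h2
      exact absurd h1 (not_le.2 h2)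
    exact ⟨σ, hlim, (NCImpute.tendsto_factorization hU hV hlim).congr fun j => ((hsvd' j).eq).symm,
      NCImpute.isFirstOrderStationary_of_subseq hPdiff hX hκ hsvd' hres hU hV strictMono_id hlim⟩
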